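/- Let $E=E_\rho\oplus iE_\rho$ be a universally complete Archimedean complex vector lattice: $E_\rho$ is an Archimedean real vector lattice that is Dedekind complete and in which every nonempty set of pairwise disjoint positive elements has a supremum, and $E$ carries the modulus $|f+ig|=\sup\{(\cos\theta)f+(\sin\theta)g:\theta\in[0,2\pi]\}$ $(f,g\in E_\rho)$. The space $E_\rho$ is endowed with its multiplication as an $f$-algebra with identity $e$, which is extended canonically to $E$; put $z^0=e$ for $z\in E$, and for $x\in E_+$ and $n\ge 1$ let $x^{1/n}$ be the unique element of $E_+$ whose $n$th power is $x$. Here $E_+=\{f\in E:|f|=f\}$ is the positive cone, which is that of $E_\rho$. Let $c\in E$, let $a_n\in E$ for $n\ge 0$, and consider the power series $S(z)=\sum_{n=0}^\infty a_n(z-c)^n$. For $r\in E_+$ let $\bar\Delta(c,r)=\{z\in E:|z-c|\le r\}$. The series *converges uniformly in order* on $D\subseteq E$, with sum $S(z)$ for $z\in D$, if there is a decreasing sequence $(p_m)_{m\ge 0}$ in $E_\rho$ with $\inf_m p_m=0$ such that $$\Bigl|\sum_{n=0}^m a_n(z-c)^n-S(z)\Bigr|\le p_m\qquad\text{for all } z\in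 D \text{ and } m\ge 0.$$ Let $$\Omega_S=\{r\in E_+ : S(z)\text{ converges uniformly in order on }\bar\Delta(c,r)\}.$$ (i) $\Omega_S$ is a solid sublattice of $E_+$: it is nonempty, it is closed under finite suprema and infima, and if $r\in\Omega_S$ and $0\le s\le r$, then $s\in\Omega_S$. (ii) If the sequence $(|a_n|^{1/n})_{n\ge1}$ is order bounded, put $L=\limsup_{n\to\infty}|a_n|^{1/n}=\inf_{n\ge1}\sup_{m\ge n}|a_m|^{1/m}$, let $B_L$ be the band of $E$ generated by $L$, and let $B_L^d=\{z\in E:|z|\wedge|w|=0\text{ for all }w\in B_L\}$ be its disjoint complement. Then $(B_L^d)_+=B_L^d\cap E_+\subseteq\Omega_S$. -/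

import Mathlib

open Set

namespace CVL

/-! ### Real vector lattices and `Φ`-algebras -/

/-- The Archimedean property of a vector lattice (Mathlib's `Archimedean` is a different property
on orders that are not total). -/
class IsArchimedeanLattice (A : Type*) [AddCommGroup A] [Lattice A] : Prop where
  nonpos_of_nsmul_le : ∀ x y : A, (∀ n : ℕ, n • x ≤ y) → x ≤ 0

/-- A vector lattice is universally complete if it is Dedekind complete, which is
`ConditionallyCompleteLattice A`, and laterally complete: every nonempty set of pairwise disjoint
positive elements has a supremum. -/
class IsUniversallyComplete (A : Type*) [AddCommGroup A] [ConditionallyCompleteLattice A] :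
    Prop where
  exists_isLUB_of_pairwise_disjoint : ∀ D : Set A, D.Nonempty → (∀ x ∈ D, 0 ≤ x) →
    D.Pairwise (fun x y => x ⊓ y = 0) → ∃ s, IsLUB D s

/-- An `f`-algebra: products of positive elements are positive, and multiplication by a positive
element, on either side, preserves disjointness. The multiplication is associative, as in every
`Ring`, and not assumed to be commutative. An `f`-algebra that is a (unital) `Ring` is a
`Φ`-algebra; its identity `e` is `1`. -/
class IsFAlgebra (A : Type*) [Ring A] [Lattice A] : Prop where
  mul_nonneg : ∀ a b : A, 0 ≤ a → 0 ≤ b → 0 ≤ a * b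
  mul_left_inf_eq_zero : ∀ a b c : A, a ⊓ b = 0 → 0 ≤ c → (c * a) ⊓ b = 0
  mul_right_inf_eq_zero : ∀ a b c : A, a ⊓ b = 0 → 0 ≤ c → (a * c) ⊓ b = 0

/-! ### The complexification `A ⊕ iA` -/

/-- The vector space complexification `A ⊕ iA`, with elements `re + i im`. -/
@[ext]
structure Cplx (A : Type*) where
  re : A
  im : A

namespace Cplx

section Algebra

variable {A : Type*} [Ring A]

instance : Zero (Cplx A) := ⟨⟨0, 0⟩⟩
instance : One (Cplx A) := ⟨⟨1, 0⟩⟩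
instance : Add (Cplx A) := ⟨fun z w => ⟨z.re + w.re, z.im + w.im⟩⟩
instance : Neg (Cplx A) := ⟨fun z => ⟨-z.re, -z.im⟩⟩
instance : Sub (Cplx A) := ⟨fun z w => ⟨z.re - w.re, z.im - w.im⟩⟩
instance : Mul (Cplx A) :=
  ⟨fun z w => ⟨z.re * w.re - z.im * w.im, z.re * w.im + z.im * w.re⟩⟩

@[simp] theorem zero_re : (0 : Cplx A).re = 0 := rfl
@[simp] theorem zero_im : (0 : Cplx A).im = 0 := rfl
@[simp] theorem one_re : (1 : Cplx A).re = 1 := rfl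
@[simp] theorem one_im : (1 : Cplx A).im = 0 := rfl
@[simp] theorem add_re (z w : Cplx A) : (z + w).re = z.re + w.re := rfl
@[simp] theorem add_im (z w : Cplx A) : (z + w).im = z.im + w.im := rfl
@[simp] theorem neg_re (z : Cplx A) : (-z).re = -z.re := rfl
@[simp] theorem neg_im (z : Cplx A) : (-z).im = -z.im := rfl
@[simp] theorem sub_re (z w : Cplx A) : (z - w).re = z.re - w.re := rfl
@[simp] theorem sub_im (z w : Cplx A) : (z - w).im = z.im - w.im := rfl
@[simp] theorem mul_re (z w : Cplx A) : (z * w).re = z.re * w.re - z.im * w.im := rfl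
@[simp] theorem mul_im (z w : Cplx A) : (z * w).im = z.re * w.im + z.im * w.re := rfl

instance : Ring (Cplx A) where
  add_assoc _ _ _ := by ext <;> simp [add_assoc]
  zero_add _ := by ext <;> simp
  add_zero _ := by ext <;> simp
  add_comm _ _ := by ext <;> simp [add_comm]
  left_distrib _ _ _ := by ext <;> simp [mul_add] <;> abel
  right_distrib _ _ _ := by ext <;> simp [add_mul] <;> abel
  zero_mul _ := by ext <;> simp
  mul_zero _ := by ext <;> simp
  mul_assoc _ _ _ := by ext <;> simp [mul_add, add_mul, mul_sub, sub_mul, mul_assoc] <;> abel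
  one_mul _ := by ext <;> simp
  mul_one _ := by ext <;> simp
  neg_add_cancel _ := by ext <;> simp
  sub_eq_add_neg _ _ := by ext <;> simp [sub_eq_add_neg]
  nsmul := nsmulRec
  zsmul := zsmulRec

variable [Algebra ℝ A]

instance : SMul ℂ (Cplx A) :=
  ⟨fun α z => ⟨α.re • z.re - α.im • z.im, α.re • z.im + α.im • z.re⟩⟩

@[simp] theorem smul_re (α : ℂ) (z : Cplx A) : (α • z).re = α.re • z.re - α.im • z.im := rfl
@[simp] theorem smul_im (α : ℂ) (z : Cplx A) : (α • z).im = α.re • z.im + α.im • z.re := rfl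

instance : Module ℂ (Cplx A) where
  one_smul _ := by ext <;> simp
  mul_smul _ _ _ := by
    ext <;> simp [smul_sub, smul_add, sub_smul, add_smul, mul_smul] <;> abel
  smul_zero _ := by ext <;> simp
  zero_smul _ := by ext <;> simp
  smul_add _ _ _ := by ext <;> simp <;> abel
  add_smul _ _ _ := by ext <;> simp [add_smul] <;> abel

/-- The inclusion of the real part `A` in `A ⊕ iA`. -/
def ofReal (x : A) : Cplx A := ⟨x, 0⟩

end Algebra

/-! ### Modulus, roots, limit superior -/

section Order

variable {A : Type*} [Ring A] [ConditionallyCompleteLattice A] [Algebra ℝ A]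

/-- The modulus `|f + ig| = sup {(cos θ) f + (sin θ) g : θ ∈ [0, 2π]}`. -/
noncomputable def modulus (z : Cplx A) : A :=
  ⨆ θ : Icc (0 : ℝ) (2 * Real.pi), (Real.cos θ • z.re + Real.sin θ • z.im)

/-- The supremum that defines the modulus is a genuine one. -/
theorem isLUB_modulus [IsOrderedAddMonoid A] [PosSMulMono ℝ A] (z : Cplx A) :
    IsLUB (range fun θ : Icc (0 : ℝ) (2 * Real.pi) =>
      Real.cos θ • z.re + Real.sin θ • z.im) z.modulus := by
  have key : ∀ (t : ℝ) (x : A), |t| ≤ 1 → t • x ≤ |x| := by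
    intro t x ht
    have h1 : t • x ≤ |t| • |x| := by
      rcases le_total 0 t with h | h
      · rw [abs_of_nonneg h]
        exact smul_le_smul_of_nonneg_left (le_abs_self x) h
      · rw [abs_of_nonpos h, ← neg_smul_neg]
        exact smul_le_smul_of_nonneg_left (neg_le_abs x) (neg_nonneg.2 h)
    have h2 : 0 ≤ (1 - |t|) • |x| := smul_nonneg (sub_nonneg.2 ht) (abs_nonneg x)
    rw [sub_smul, one_smul, sub_nonneg] at h2
    exact h1.trans h2
  have : Nonempty (Icc (0 : ℝ) (2 * Real.pi)) := ⟨⟨0, le_refl 0, Real.two_pi_pos.le⟩⟩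
  refine isLUB_csSup (range_nonempty _) ⟨|z.re| + |z.im|, ?_⟩
  rintro _ ⟨θ, rfl⟩
  exact add_le_add (key _ _ (Real.abs_cos_le_one _)) (key _ _ (Real.abs_sin_le_one _))

end Order

end Cplx

section Roots

variable {A : Type*} [Ring A] [ConditionallyCompleteLattice A]

open Classical in
/-- The positive `n`-th root `a^{1/n}` of `a`: the element `r ≥ 0` with `r ^ n = a`. In a
universally complete `Φ`-algebra it exists and is unique for `0 ≤ a` and `n ≥ 1`. -/
noncomputable def nthRoot (n : ℕ) (a : A) : A :=
  if h : ∃ r : A, 0 ≤ r ∧ r ^ n = a then h.choose else 0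

/-- `limsup x_n = inf_n sup_{m ≥ n} x_m`, for an order bounded sequence. -/
noncomputable def orderLimsup (x : ℕ → A) : A :=
  ⨅ n : ℕ, ⨆ m : Ici n, x m

/-- A set is order bounded if it is contained in an order interval. -/
def IsOrderBounded (D : Set A) : Prop :=
  ∃ l u : A, D ⊆ Icc l u

end Roots

section Complex

variable {A : Type*} [Ring A] [ConditionallyCompleteLattice A] [Algebra ℝ A]

/-- The sequence `(|a_n|^{1/n})_{n ≥ 1}`; the index `k` stands for `n = k + 1`. -/
noncomputable def rootSeq (a : ℕ → Cplx A) (k : ℕ) : A :=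
  nthRoot (k + 1) (a (k + 1)).modulus

/-! ### Bands and disjoint complements -/

/-- A band of `A ⊕ iA`: a linear subspace that is solid and contains the suprema that exist in `A`
of its nonempty sets of real elements. -/
structure IsBand (B : Submodule ℂ (Cplx A)) : Prop where
  solid : ∀ z w : Cplx A, z ∈ B → w.modulus ≤ z.modulus → w ∈ B
  sup_mem : ∀ (D : Set A) (s : A), D.Nonempty → (∀ x ∈ D, Cplx.ofReal x ∈ B) → IsLUB D s →
    Cplx.ofReal s ∈ B

/-- The band generated by `a`: the intersection of all bands that contain `a`. -/
def bandGenerated (a : Cplx A) : Submodule ℂ (Cplx A) :=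
  sInf {B | IsBand B ∧ a ∈ B}

/-- The disjoint complement of a set. -/
def disjointComplement (D : Set (Cplx A)) : Set (Cplx A) :=
  {z | ∀ w ∈ D, z.modulus ⊓ w.modulus = 0}

/-! ### Power series -/

/-- The order closed ball with center `c` and radius `r`. -/
def orderBall (c : Cplx A) (r : A) : Set (Cplx A) :=
  {z | (z - c).modulus ≤ r}

/-- The power series `∑ a_n (z - c)^n` converges uniformly in order on `D`: for some function
`S` and some sequence `p` that decreases to `0`, the `m`-th partial sum at `z` differs from `S z`
by at most `p m`, for all `z` in `D` and all `m`. In particular `S z` is the order limit of the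
partial sums at `z`. -/
def ConvergesUniformlyInOrder (a : ℕ → Cplx A) (c : Cplx A) (D : Set (Cplx A)) : Prop :=
  ∃ (S : Cplx A → Cplx A) (p : ℕ → A), Antitone p ∧ IsGLB (range p) 0 ∧
    ∀ m : ℕ, ∀ z ∈ D,
      (∑ n ∈ Finset.range (m + 1), a n * (z - c) ^ n - S z).modulus ≤ p m

/-- The set `Ω_S` of the radii `r` in the positive cone for which the power series
`∑ a_n (z - c)^n` converges uniformly in order on the ball with center `c` and radius `r`. The
positive cone of `A ⊕ iA` is that of `A`. -/
def radiiSet (a : ℕ → Cplx A) (c : Cplx A) : Set A :=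
  {r | 0 ≤ r ∧ ConvergesUniformlyInOrder a c (orderBall c r)}

end Complex

/-- A solid sublattice of the positive cone: a nonempty set of positive elements that is closed
under binary suprema and infima and contains every positive element below one of its elements. -/
structure IsSolidSublatticeOfCone {A : Type*} [AddCommGroup A] [Lattice A] (W : Set A) :
    Prop where
  nonneg : ∀ r ∈ W, 0 ≤ r
  nonempty : W.Nonempty
  solid : ∀ r ∈ W, ∀ s, 0 ≤ s → s ≤ r → s ∈ W
  sup_mem : ∀ r ∈ W, ∀ s ∈ W, r ⊔ s ∈ W
  inf_mem : ∀ r ∈ W, ∀ s ∈ W, r ⊓ s ∈ W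

end CVL

/-!
Components of the identity, that is, idempotents between `0` and `1`, take the place of measurable
sets, and multiplication by a component is a band projection.

For (i), choose a component `e` with `e * s ≤ e * r` and `(1 - e) * r ≤ (1 - e) * s`. If
`|w| ≤ r ⊔ s`, then `|e w| ≤ r` and `|(1 - e) w| ≤ s`, while
`w ^ n = (e w) ^ n + ((1 - e) w) ^ n - 0 ^ n`, so that the series on the ball of radius `r ⊔ s` is
the sum of two uniformly convergent series and a constant.

For (ii), let `v_n = sup_{m ≥ n} |a_m|^{1/m}`. As `r` is disjoint to `L`, the sequence `v_n * r`
decreases to `L * r = 0`. By an Egorov argument there are components `e_N` decreasing to `0` off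
which `v_N * r ≤ 1 / 8`, and off `e_N` the series is dominated by a geometric one. Lateral
completeness glues the bounds for the partial sums on the disjoint layers `e_N - e_{N+1}` to a
single bound, and the Weierstrass test applies.
-/

namespace CVL

section VectorLattice

section Lattice

variable {A : Type*} [AddCommGroup A] [Lattice A] [IsOrderedAddMonoid A]

theorem inf_eq_zero_of_isLUB {D : Set A} {s w : A} (hne : D.Nonempty) (hs : IsLUB D s)
    (h : ∀ y ∈ D, w ⊓ y = 0) : w ⊓ s = 0 := by
  obtain ⟨y₀, hy₀⟩ := hne
  have hw : 0 ≤ w := h y₀ hy₀ ▸ inf_le_left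
  have hs₀ : 0 ≤ s := (h y₀ hy₀ ▸ inf_le_right : 0 ≤ y₀).trans (hs.1 hy₀)
  have hsup : s ≤ w ⊔ s - w := hs.2 fun y hy => by
    rw [le_sub_iff_add_le', ← inf_add_sup w y, h y hy, zero_add]
    exact sup_le_sup_left (hs.1 hy) w
  refine le_antisymm ?_ (le_inf hw hs₀)
  rwa [le_sub_iff_add_le', ← inf_add_sup w s, add_le_iff_nonpos_left] at hsup

theorem isGLB_range_add_of_antitone {p q : ℕ → A} {x y : A} (hp : Antitone p)
    (hq : Antitone q) (hpx : IsGLB (range p) x) (hqy : IsGLB (range q) y) :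
    IsGLB (range (p + q)) (x + y) := by
  refine ⟨?_, fun b hb => ?_⟩
  · rintro _ ⟨m, rfl⟩
    exact add_le_add (hpx.1 ⟨m, rfl⟩) (hqy.1 ⟨m, rfl⟩)
  · rw [← sub_le_iff_le_add]
    refine hpx.2 ?_
    rintro _ ⟨m, rfl⟩
    rw [sub_le_iff_le_add, ← sub_le_iff_le_add']
    refine hqy.2 ?_
    rintro _ ⟨k, rfl⟩
    rw [sub_le_iff_le_add']
    exact (hb ⟨max m k, rfl⟩).trans
      (add_le_add (hp (le_max_left m k)) (hq (le_max_right m k)))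

theorem smul_le_abs [Module ℝ A] [PosSMulMono ℝ A] {t : ℝ} (ht : |t| ≤ 1) (x : A) :
    t • x ≤ |x| := by
  obtain ⟨ht₁, ht₂⟩ := abs_le.1 ht
  have hconvex : |x| - t • x = ((1 - t) / 2) • (|x| + x) + ((1 + t) / 2) • (|x| - x) := by
    module
  rw [← sub_nonneg, hconvex]
  exact add_nonneg
    (smul_nonneg (by linarith) (neg_le_iff_add_nonneg.1 (neg_le_abs x)))
    (smul_nonneg (by linarith) (sub_nonneg.2 (le_abs_self x)))

end Lattice

variable {A : Type*} [AddCommGroup A] [ConditionallyCompleteLattice A] [IsOrderedAddMonoid A]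

theorem nonpos_of_forall_nsmul_le {x y : A} (h : ∀ n : ℕ, n • x ≤ y) : x ≤ 0 := by
  have hlub : IsLUB (range fun n : ℕ => n • x) (⨆ n : ℕ, n • x) :=
    isLUB_ciSup ⟨y, forall_mem_range.2 h⟩
  have hshift : ⨆ n : ℕ, n • x ≤ (⨆ n : ℕ, n • x) - x := hlub.2 <| forall_mem_range.2 fun n => by
    rw [le_sub_iff_add_le, ← succ_nsmul]
    exact hlub.1 ⟨n + 1, rfl⟩
  rwa [le_sub_self_iff] at hshift

theorem nonpos_of_forall_le_smul [Module ℝ A] [PosSMulMono ℝ A] {x y : A}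
    (h : ∀ ε : ℝ, 0 < ε → ε ≤ 1 → x ≤ ε • y) : x ≤ 0 := by
  refine nonpos_of_forall_nsmul_le (y := y⁺) fun n => ?_
  rcases Nat.eq_zero_or_pos n with rfl | hn
  · rw [zero_nsmul]
    exact posPart_nonneg y
  · have hn' : (1 : ℝ) ≤ n := by exact_mod_cast hn
    calc n • x = (n : ℝ) • x := (Nat.cast_smul_eq_nsmul ℝ n x).symm
      _ ≤ (n : ℝ) • (n : ℝ)⁻¹ • y :=
        smul_le_smul_of_nonneg_left (h _ (by positivity) (inv_le_one_of_one_le₀ hn'))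
          (by positivity)
      _ = y := smul_inv_smul₀ (by positivity) y
      _ ≤ y⁺ := le_posPart y

theorem exists_forall_abs_sub_le {x p : ℕ → A} (h : ∀ m k, m ≤ k → |x m - x k| ≤ p m) :
    ∃ l, ∀ m, |x m - l| ≤ p m := by
  have hp : ∀ m, 0 ≤ p m := fun m => (abs_nonneg _).trans (h m m le_rfl)
  have hcross : ∀ i j, x i - p i ≤ x j + p j := by
    intro i j
    rw [sub_le_iff_le_add, add_assoc, ← sub_le_iff_le_add']
    rcases le_total i j with hij | hji
    · exact ((le_abs_self _).trans (h i j hij)).trans (le_add_of_nonneg_left (hp j))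
    · rw [← neg_sub]
      exact ((neg_le_abs _).trans (h j i hji)).trans (le_add_of_nonneg_right (hp i))
  have hlub : IsLUB (range fun k => x k - p k) (⨆ k, (x k - p k)) :=
    isLUB_ciSup ⟨x 0 + p 0, forall_mem_range.2 fun k => hcross k 0⟩
  refine ⟨⨆ k, (x k - p k), fun m => abs_le'.2 ⟨sub_le_comm.1 (hlub.1 ⟨m, rfl⟩), ?_⟩⟩
  rw [neg_sub, sub_le_iff_le_add']
  exact hlub.2 (forall_mem_range.2 fun k => hcross k m)

end VectorLattice

section Idempotent

variable {R : Type*} [Ring R]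

theorem mul_add_one_sub_mul (e x : R) : e * x + (1 - e) * x = x := by
  rw [← add_mul, add_sub_cancel, one_mul]

theorem le_of_mul_le_mul_of_one_sub_mul_le_mul [PartialOrder R] [IsOrderedAddMonoid R]
    {e x y : R} (h : e * x ≤ e * y) (h' : (1 - e) * x ≤ (1 - e) * y) : x ≤ y := by
  rw [← mul_add_one_sub_mul e x, ← mul_add_one_sub_mul e y]
  exact add_le_add h h'

theorem idempotent_mul_add_one_sub_mul_pow {e : R} (he : IsIdempotentElem e)
    (hcomm : ∀ x, Commute e x) (x y : R) (n : ℕ) :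
    (e * x + (1 - e) * y) ^ n = e * x ^ n + (1 - e) * y ^ n := by
  induction n with
  | zero => rw [pow_zero, pow_zero, pow_zero, mul_add_one_sub_mul]
  | succ n ih =>
    have hcomm' : ∀ z, Commute (1 - e) z := fun z => (Commute.one_left z).sub_left (hcomm z)
    have hmul : ∀ f g u v : R, (∀ z, Commute g z) → f * u * (g * v) = f * g * (u * v) :=
      fun f g u v hg => by rw [mul_assoc, ← mul_assoc u, ← (hg u).eq, mul_assoc g, ← mul_assoc]
    rw [pow_succ, ih, mul_add, add_mul, add_mul, hmul e e _ _ hcomm, hmul _ e _ _ hcomm,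
      hmul e _ _ _ hcomm', hmul _ _ _ _ hcomm', he.eq, he.one_sub.eq, he.mul_one_sub_self,
      he.one_sub_mul_self, zero_mul, zero_mul, add_zero, zero_add, ← pow_succ, ← pow_succ]

theorem pow_eq_idempotent_mul_pow_add_pow_sub {e : R} (he : IsIdempotentElem e)
    (hcomm : ∀ x, Commute e x) (x : R) (n : ℕ) :
    x ^ n = (e * x) ^ n + ((1 - e) * x) ^ n - 0 ^ n := by
  have h := idempotent_mul_add_one_sub_mul_pow he hcomm x 0 n
  have h' := idempotent_mul_add_one_sub_mul_pow he hcomm 0 x n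
  rw [mul_zero, add_zero] at h
  rw [mul_zero, zero_add] at h'
  rw [h, h']
  noncomm_ring

end Idempotent

section IsComponent

variable {A : Type*} [Ring A]

/-- A component of the identity: a central idempotent between `0` and `1`. Multiplication by a
component `e` is the band projection onto the band generated by `e`. -/
structure IsComponent [LE A] (e : A) : Prop where
  nonneg : 0 ≤ e
  le_one : e ≤ 1
  isIdempotentElem : IsIdempotentElem e
  commute : ∀ x, Commute e x

namespace IsComponent

theorem one_sub [PartialOrder A] [IsOrderedAddMonoid A] {e : A} (he : IsComponent e) :
    IsComponent (1 - e) where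
  nonneg := sub_nonneg.2 he.le_one
  le_one := sub_le_self _ he.nonneg
  isIdempotentElem := he.isIdempotentElem.one_sub
  commute x := (Commute.one_left x).sub_left (he.commute x)

theorem mul_mul_self [LE A] {e : A} (he : IsComponent e) (x : A) : e * (e * x) = e * x := by
  rw [← mul_assoc, he.isIdempotentElem.eq]

section PartialOrder

variable [PartialOrder A] [IsOrderedRing A] {e f x y : A}

theorem mul_le_self (he : IsComponent e) (hx : 0 ≤ x) : e * x ≤ x :=
  mul_le_of_le_one_left hx he.le_one

theorem mul (he : IsComponent e) (hf : IsComponent f) : IsComponent (e * f) where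
  nonneg := mul_nonneg he.nonneg hf.nonneg
  le_one := mul_le_one₀ he.le_one hf.nonneg hf.le_one
  isIdempotentElem := he.isIdempotentElem.mul_of_commute (he.commute f) hf.isIdempotentElem
  commute x := (he.commute x).mul_left (hf.commute x)

theorem mul_eq_right_of_le (he : IsComponent e) (hf : IsComponent f) (h : f ≤ e) :
    e * f = f := by
  refine le_antisymm (he.mul_le_self hf.nonneg) ?_
  calc f = f * f := hf.isIdempotentElem.eq.symm
    _ ≤ e * f := mul_le_mul_of_nonneg_right h hf.nonneg

theorem sub (he : IsComponent e) (hf : IsComponent f) (h : f ≤ e) : IsComponent (e - f) := by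
  have hsub : e - f = e * (1 - f) := by rw [mul_sub, mul_one, he.mul_eq_right_of_le hf h]
  exact hsub ▸ he.mul hf.one_sub

theorem mul_mul_pow_le [Algebra ℝ A] [PosSMulMono ℝ A] (he : IsComponent e) (hx : 0 ≤ x)
    (hy : 0 ≤ y) {ε : ℝ} (hε : 0 ≤ ε) (h : e * (x * y) ≤ ε • e) (n : ℕ) :
    e * (x ^ n * y ^ n) ≤ ε ^ n • e := by
  induction n with
  | zero => simp
  | succ n ih =>
    calc e * (x ^ (n + 1) * y ^ (n + 1)) = x ^ n * (e * (x * y)) * y ^ n := by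
          rw [pow_succ, pow_succ', ← mul_assoc (x ^ n) e, ← (he.commute (x ^ n)).eq]
          simp only [mul_assoc]
      _ ≤ x ^ n * (ε • e) * y ^ n :=
          mul_le_mul_of_nonneg_right (mul_le_mul_of_nonneg_left h (pow_nonneg hx n))
            (pow_nonneg hy n)
      _ = ε • (e * (x ^ n * y ^ n)) := by
          rw [mul_smul_comm, smul_mul_assoc, ← (he.commute (x ^ n)).eq, mul_assoc]
      _ ≤ ε • ε ^ n • e := smul_le_smul_of_nonneg_left ih hε
      _ = ε ^ (n + 1) • e := by rw [smul_smul, pow_succ']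

end PartialOrder

section Lattice

variable [Lattice A] [IsOrderedRing A] {e x y : A}

theorem inf_one_sub (he : IsComponent e) : e ⊓ (1 - e) = 0 := by
  refine le_antisymm (le_of_mul_le_mul_of_one_sub_mul_le_mul (e := e) ?_ ?_)
    (le_inf he.nonneg he.one_sub.nonneg)
  · rw [mul_zero, ← he.isIdempotentElem.mul_one_sub_self]
    exact mul_le_mul_of_nonneg_left inf_le_right he.nonneg
  · rw [mul_zero, ← he.isIdempotentElem.one_sub_mul_self]
    exact mul_le_mul_of_nonneg_left inf_le_left he.one_sub.nonneg

theorem mul_sup_eq (he : IsComponent e) (h : e * y ≤ e * x) : e * (x ⊔ y) = e * x := by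
  refine le_antisymm ?_ (mul_le_mul_of_nonneg_left le_sup_left he.nonneg)
  have hle : x ⊔ y ≤ e * x + (1 - e) * (x ⊔ y) := sup_le
    ((mul_add_one_sub_mul e x).symm.trans_le
      (add_le_add le_rfl (mul_le_mul_of_nonneg_left le_sup_left he.one_sub.nonneg)))
    ((mul_add_one_sub_mul e y).symm.trans_le
      (add_le_add h (mul_le_mul_of_nonneg_left le_sup_right he.one_sub.nonneg)))
  nth_rw 1 [← mul_add_one_sub_mul e (x ⊔ y)] at hle
  exact le_of_add_le_add_right hle

theorem sup_eq (he : IsComponent e) (h : e * y ≤ e * x) (h' : (1 - e) * x ≤ (1 - e) * y) :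
    x ⊔ y = e * x + (1 - e) * y := by
  rw [← he.mul_sup_eq h, ← he.one_sub.mul_sup_eq h', sup_comm y x, mul_add_one_sub_mul]

theorem pairwise_sub_succ_inf_eq_zero {f : ℕ → A} (hf : ∀ n, IsComponent (f n))
    (hanti : Antitone f) : Pairwise fun i j => (f i - f (i + 1)) ⊓ (f j - f (j + 1)) = 0 := by
  have hnonneg : ∀ i, 0 ≤ f i - f (i + 1) := fun i => sub_nonneg.2 (hanti i.le_succ)
  have : Std.Symm fun i j => (f i - f (i + 1)) ⊓ (f j - f (j + 1)) = 0 :=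
    ⟨fun _ _ h => (inf_comm _ _).trans h⟩
  refine pairwise_iff_lt.2 fun i j hij => ?_
  refine le_antisymm ?_ (le_inf (hnonneg i) (hnonneg j))
  rw [← (hf (i + 1)).inf_one_sub, inf_comm]
  exact inf_le_inf ((sub_le_self _ (hf _).nonneg).trans (hanti hij))
    (sub_le_sub_right (hf i).le_one _)

end Lattice

end IsComponent

end IsComponent

section FAlgebra

section Lattice

variable {A : Type*} [Ring A] [Lattice A] [IsFAlgebra A] {a b c d : A}

theorem mul_inf_mul_eq_zero (h : a ⊓ b = 0) (hc : 0 ≤ c) (hd : 0 ≤ d) :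
    (a * c) ⊓ (b * d) = 0 := by
  have hac : b ⊓ (a * c) = 0 := inf_comm b _ ▸ IsFAlgebra.mul_right_inf_eq_zero a b c h hc
  rw [inf_comm]
  exact IsFAlgebra.mul_right_inf_eq_zero b (a * c) d hac hd

theorem mul_eq_zero_of_inf_eq_zero (h : a ⊓ b = 0) : a * b = 0 := by
  have ha : 0 ≤ a := h ▸ inf_le_left
  have hb : 0 ≤ b := h ▸ inf_le_right
  have hab : b ⊓ (a * b) = 0 := inf_comm b _ ▸ IsFAlgebra.mul_right_inf_eq_zero a b b h hb
  rw [← inf_idem (a * b)]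
  exact IsFAlgebra.mul_left_inf_eq_zero b (a * b) a hab ha

variable [IsOrderedAddMonoid A]

instance IsFAlgebra.toIsOrderedRing : IsOrderedRing A := by
  have hneg : (1 : A)⁻ = -((1 : A)⁻ * 1⁻) := by
    have hdisj : (1 : A)⁺ * 1⁻ = 0 := mul_eq_zero_of_inf_eq_zero (posPart_inf_negPart_eq_zero 1)
    calc (1 : A)⁻ = (1⁺ - 1⁻) * 1⁻ := by rw [posPart_sub_negPart, one_mul]
      _ = -((1 : A)⁻ * 1⁻) := by rw [sub_mul, hdisj, zero_sub]
  have hneg_nonpos : (1 : A)⁻ ≤ 0 := by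
    rw [hneg, neg_nonpos]
    exact IsFAlgebra.mul_nonneg _ _ (negPart_nonneg _) (negPart_nonneg _)
  have : ZeroLEOneClass A := ⟨negPart_eq_zero.1 (le_antisymm hneg_nonpos (negPart_nonneg _))⟩
  exact IsOrderedRing.of_mul_nonneg fun a b => IsFAlgebra.mul_nonneg a b

theorem IsComponent.of_inf_one_sub_eq_zero {e : A} (h : e ⊓ (1 - e) = 0) : IsComponent e := by
  have he : 0 ≤ e := h ▸ inf_le_left
  have hcomm : ∀ x : A, 0 ≤ x → Commute e x := by
    intro x hx
    have hright : e * x * (1 - e) = 0 :=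
      mul_eq_zero_of_inf_eq_zero (IsFAlgebra.mul_right_inf_eq_zero _ _ _ h hx)
    have hleft : (1 - e) * (x * e) = 0 := mul_eq_zero_of_inf_eq_zero <| by
      rw [inf_comm]
      exact IsFAlgebra.mul_left_inf_eq_zero _ _ _ h hx
    rw [mul_sub, mul_one, sub_eq_zero] at hright
    rw [sub_mul, one_mul, sub_eq_zero] at hleft
    rw [Commute, SemiconjBy, hright, hleft, mul_assoc]
  refine ⟨he, sub_nonneg.1 (h ▸ inf_le_right), ?_, fun x => ?_⟩
  · exact isIdempotentElem_iff_mul_one_sub_self.2 (mul_eq_zero_of_inf_eq_zero h)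
  · rw [← posPart_sub_negPart x]
    exact (hcomm _ (posPart_nonneg x)).sub_right (hcomm _ (negPart_nonneg x))

end Lattice

section Support

variable {A : Type*} [Ring A] [ConditionallyCompleteLattice A]

/-- The component of the identity in the band generated by `x⁺`, which is where `x` is
positive. -/
noncomputable def supportComponent (x : A) : A := ⨆ k : ℕ, (k • x⁺) ⊓ 1

theorem isLUB_supportComponent (x : A) :
    IsLUB (range fun k : ℕ => (k • x⁺) ⊓ 1) (supportComponent x) :=
  isLUB_ciSup ⟨1, forall_mem_range.2 fun _ => inf_le_right⟩

variable [IsOrderedAddMonoid A]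

theorem supportComponent_mono : Monotone (supportComponent (A := A)) := fun x y h =>
  (isLUB_supportComponent x).2 <| forall_mem_range.2 fun k =>
    (inf_le_inf_right 1 (nsmul_le_nsmul_right (posPart_mono h) k)).trans
      ((isLUB_supportComponent y).1 ⟨k, rfl⟩)

theorem one_sub_supportComponent_inf_posPart (x : A) : (1 - supportComponent x) ⊓ x⁺ = 0 := by
  have hle_one : supportComponent x ≤ 1 :=
    (isLUB_supportComponent x).2 (forall_mem_range.2 fun _ => inf_le_right)
  refine le_antisymm ?_ (le_inf (sub_nonneg.2 hle_one) (posPart_nonneg x))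
  rw [← le_sub_self_iff (supportComponent x)]
  refine (isLUB_supportComponent x).2 (forall_mem_range.2 fun k => ?_)
  rw [le_sub_iff_add_le]
  refine le_trans (le_inf ?_ ?_) ((isLUB_supportComponent x).1 ⟨k + 1, rfl⟩)
  · rw [succ_nsmul]
    exact add_le_add inf_le_left inf_le_right
  · calc (k • x⁺) ⊓ 1 + (1 - supportComponent x) ⊓ x⁺
        ≤ supportComponent x + (1 - supportComponent x) :=
          add_le_add ((isLUB_supportComponent x).1 ⟨k, rfl⟩) inf_le_left
      _ = 1 := add_sub_cancel _ _

variable [IsFAlgebra A]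

theorem inf_supportComponent_eq_zero {w x : A} (h : w ⊓ x⁺ = 0) :
    w ⊓ supportComponent x = 0 := by
  refine inf_eq_zero_of_isLUB (range_nonempty _) (isLUB_supportComponent x)
    (forall_mem_range.2 fun k => ?_)
  have hk : w ⊓ k • x⁺ = 0 := by
    rw [inf_comm, nsmul_eq_mul]
    exact IsFAlgebra.mul_left_inf_eq_zero _ _ _ (inf_comm w _ ▸ h) (Nat.cast_nonneg k)
  rw [← inf_assoc, hk, inf_eq_left]
  exact zero_le_one

theorem isComponent_supportComponent (x : A) : IsComponent (supportComponent x) :=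
  .of_inf_one_sub_eq_zero <| by
    rw [inf_comm]
    exact inf_supportComponent_eq_zero (one_sub_supportComponent_inf_posPart x)

theorem supportComponent_mul_eq_mul_posPart (x : A) :
    supportComponent x * x = supportComponent x * x⁺ := by
  have hdisj : supportComponent x ⊓ x⁻ = 0 := by
    rw [inf_comm]
    exact inf_supportComponent_eq_zero (inf_comm x⁺ _ ▸ posPart_inf_negPart_eq_zero x)
  nth_rw 2 [← posPart_sub_negPart x]
  rw [mul_sub, mul_eq_zero_of_inf_eq_zero hdisj, sub_zero]

theorem supportComponent_mul_nonneg (x : A) : 0 ≤ supportComponent x * x := by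
  rw [supportComponent_mul_eq_mul_posPart]
  exact mul_nonneg (isComponent_supportComponent x).nonneg (posPart_nonneg x)

theorem one_sub_supportComponent_mul_nonpos (x : A) : (1 - supportComponent x) * x ≤ 0 := by
  nth_rw 2 [← posPart_sub_negPart x]
  rw [mul_sub, mul_eq_zero_of_inf_eq_zero (one_sub_supportComponent_inf_posPart x), zero_sub,
    neg_nonpos]
  exact mul_nonneg (isComponent_supportComponent x).one_sub.nonneg (negPart_nonneg x)

theorem exists_isComponent_mul_le_mul (x y : A) :
    ∃ e, IsComponent e ∧ e * y ≤ e * x ∧ (1 - e) * x ≤ (1 - e) * y := by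
  refine ⟨supportComponent (x - y), isComponent_supportComponent _, ?_, ?_⟩
  · rw [← sub_nonneg, ← mul_sub]
    exact supportComponent_mul_nonneg (x - y)
  · rw [← sub_nonpos, ← mul_sub]
    exact one_sub_supportComponent_mul_nonpos (x - y)

end Support

end FAlgebra

section OrderContinuity

theorem IsComponent.mul_mul_mul_le {A : Type*} [Ring A] [PartialOrder A] [IsOrderedRing A]
    [Algebra ℝ A] [PosSMulMono ℝ A] {e p q z : A} {k : ℝ} (he : IsComponent e) (hk : 0 ≤ k)
    (hq : 0 ≤ q) (hz : 0 ≤ z) (hpe : e * p ≤ k • e) (hqe : e * q ≤ k • e) :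
    e * (p * z * q) ≤ (k * k) • z := by
  have hke : 0 ≤ k • e := smul_nonneg hk he.nonneg
  calc e * (p * z * q) = e * p * z * (e * q) := by
        rw [← mul_assoc (e * p * z), ← (he.commute _).eq, mul_assoc e p z, he.mul_mul_self]
        simp only [mul_assoc]
    _ ≤ k • e * z * (k • e) :=
        mul_le_mul (mul_le_mul_of_nonneg_right hpe hz) hqe (mul_nonneg he.nonneg hq)
          (mul_nonneg hke hz)
    _ = (k * k) • (e * z) := by
        rw [smul_mul_assoc, smul_mul_smul_comm, ← (he.commute _).eq, he.mul_mul_self]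
    _ ≤ (k * k) • z := smul_le_smul_of_nonneg_left (he.mul_le_self hz) (mul_nonneg hk hk)

variable {A : Type*} [Ring A] [ConditionallyCompleteLattice A] [IsOrderedAddMonoid A]
  [IsFAlgebra A] [Algebra ℝ A] [PosSMulMono ℝ A]

theorem nonpos_of_forall_isComponent_mul_nonpos {x c : A} (hc : 0 ≤ c)
    (h : ∀ (k : ℕ) (e : A), IsComponent e → e * c ≤ (k : ℝ) • e → e * x ≤ 0) : x ≤ 0 := by
  refine nonpos_of_forall_nsmul_le (y := c * x⁺) fun k => ?_
  obtain ⟨e, he, hle, hge⟩ := exists_isComponent_mul_le_mul ((k : ℝ) • (1 : A)) c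
  rw [mul_smul_comm, mul_one] at hle hge
  have hx : x ≤ (1 - e) * x⁺ := by
    rw [← zero_add ((1 - e) * x⁺)]
    nth_rw 1 [← mul_add_one_sub_mul e x]
    exact add_le_add (h k e he hle) (mul_le_mul_of_nonneg_left (le_posPart x) he.one_sub.nonneg)
  calc k • x = (k : ℝ) • x := (Nat.cast_smul_eq_nsmul ℝ k x).symm
    _ ≤ (k : ℝ) • ((1 - e) * x⁺) := smul_le_smul_of_nonneg_left hx (Nat.cast_nonneg k)
    _ = (k : ℝ) • (1 - e) * x⁺ := (smul_mul_assoc _ _ _).symm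
    _ ≤ c * x⁺ :=
      mul_le_mul_of_nonneg_right (hge.trans (he.one_sub.mul_le_self hc)) (posPart_nonneg x)

theorem isGLB_image_mul_mul {T : Set A} {l p q : A} (hT : IsGLB T l) (hp : 0 ≤ p)
    (hq : 0 ≤ q) : IsGLB ((fun y => p * y * q) '' T) (p * l * q) := by
  refine ⟨?_, fun b hb => ?_⟩
  · rintro _ ⟨y, hy, rfl⟩
    exact mul_le_mul_of_nonneg_right (mul_le_mul_of_nonneg_left (hT.1 hy) hp) hq
  rw [← sub_nonpos]
  refine nonpos_of_forall_isComponent_mul_nonpos (add_nonneg hp hq) fun k e he hk => ?_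
  have hpe : e * p ≤ (k : ℝ) • e :=
    (mul_le_mul_of_nonneg_left (le_add_of_nonneg_right hq) he.nonneg).trans hk
  have hqe : e * q ≤ (k : ℝ) • e :=
    (mul_le_mul_of_nonneg_left (le_add_of_nonneg_left hp) he.nonneg).trans hk
  set K : ℝ := k * k + 1
  have hK : 0 < K := by positivity
  have hbound : ∀ y ∈ T, e * (b - p * l * q) ≤ K • (y - l) := fun y hy => by
    have hly : 0 ≤ y - l := sub_nonneg.2 (hT.1 hy)
    calc e * (b - p * l * q) ≤ e * (p * (y - l) * q) := by
          rw [mul_sub p, sub_mul _ _ q]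
          exact mul_le_mul_of_nonneg_left (sub_le_sub_right (hb ⟨y, hy, rfl⟩) _) he.nonneg
      _ ≤ ((k : ℝ) * k) • (y - l) := he.mul_mul_mul_le (Nat.cast_nonneg k) hq hly hpe hqe
      _ ≤ K • (y - l) := smul_le_smul_of_nonneg_right (le_add_of_nonneg_right zero_le_one) hly
  have hlower : K⁻¹ • (e * (b - p * l * q)) + l ≤ l := hT.2 fun y hy => by
    rw [← le_sub_iff_add_le, inv_smul_le_iff_of_pos hK]
    exact hbound y hy
  rwa [add_le_iff_nonpos_left, inv_smul_le_iff_of_pos hK, smul_zero] at hlower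

theorem isLUB_image_mul_mul {T : Set A} {l p q : A} (hT : IsLUB T l) (hp : 0 ≤ p)
    (hq : 0 ≤ q) : IsLUB ((fun y => p * y * q) '' T) (p * l * q) := by
  refine ⟨?_, fun b hb => ?_⟩
  · rintro _ ⟨y, hy, rfl⟩
    exact mul_le_mul_of_nonneg_right (mul_le_mul_of_nonneg_left (hT.1 hy) hp) hq
  rw [← neg_le_neg_iff, ← neg_mul, ← mul_neg]
  refine (isGLB_image_mul_mul (isGLB_neg'.2 hT) hp hq).2 ?_
  rintro _ ⟨y, hy, rfl⟩
  rw [neg_le, ← neg_mul, ← mul_neg]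
  exact hb ⟨-y, hy, rfl⟩

theorem nonpos_of_forall_one_sub_mul_nonpos {e : ℕ → A} {x : A} (he : ∀ n, IsComponent (e n))
    (hinf : IsGLB (range e) 0) (h : ∀ n, (1 - e n) * x ≤ 0) : x ≤ 0 := by
  have hle : x ∈ lowerBounds ((fun y => 1 * y * x⁺) '' range e) := by
    rintro _ ⟨_, ⟨n, rfl⟩, rfl⟩
    calc x = e n * x + (1 - e n) * x := (mul_add_one_sub_mul (e n) x).symm
      _ ≤ e n * x⁺ + 0 := add_le_add (mul_le_mul_of_nonneg_left (le_posPart x) (he n).nonneg) (h n)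
      _ = 1 * e n * x⁺ := by rw [add_zero, one_mul]
  simpa only [mul_zero, zero_mul] using
    (isGLB_image_mul_mul hinf zero_le_one (posPart_nonneg x)).2 hle

end OrderContinuity

section Roots

theorem add_smul_one_pow_le {A : Type*} [Ring A] [PartialOrder A] [IsOrderedRing A]
    [Algebra ℝ A] [PosSMulMono ℝ A] {x : A} (hx : 0 ≤ x) {δ : ℝ} (hδ : 0 ≤ δ) (hδ' : δ ≤ 1)
    (n : ℕ) : (x + δ • 1) ^ n ≤ (1 - δ) • x ^ n + δ • (x + 1) ^ n := by
  induction n with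
  | zero => simp only [pow_zero, ← add_smul, sub_add_cancel, one_smul, le_refl]
  | succ n ih =>
    have hmono : 0 ≤ (δ * (1 - δ)) • ((x + 1) ^ n - x ^ n) :=
      smul_nonneg (mul_nonneg hδ (sub_nonneg.2 hδ')) <| sub_nonneg.2 <|
        pow_le_pow_left₀ hx (le_add_of_nonneg_right zero_le_one) n
    calc (x + δ • 1) ^ (n + 1) = (x + δ • 1) ^ n * (x + δ • 1) := pow_succ _ _
      _ ≤ ((1 - δ) • x ^ n + δ • (x + 1) ^ n) * (x + δ • 1) :=
        mul_le_mul_of_nonneg_right ih (add_nonneg hx (smul_nonneg hδ zero_le_one))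
      _ ≤ ((1 - δ) • x ^ n + δ • (x + 1) ^ n) * (x + δ • 1)
          + (δ * (1 - δ)) • ((x + 1) ^ n - x ^ n) := le_add_of_nonneg_right hmono
      _ = (1 - δ) • x ^ (n + 1) + δ • (x + 1) ^ (n + 1) := by
        simp only [pow_succ, mul_add, add_mul, smul_mul_assoc, mul_smul_comm, mul_one]
        module

section ConditionallyCompleteLattice

variable {A : Type*} [Ring A] [ConditionallyCompleteLattice A] [IsOrderedAddMonoid A]
  [IsFAlgebra A] {a r x y : A} {n : ℕ}

theorem sup_pow_le (hx : x ^ n ≤ a) (hy : y ^ n ≤ a) : (x ⊔ y) ^ n ≤ a := by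
  obtain ⟨e, he, hle, hge⟩ := exists_isComponent_mul_le_mul x y
  rw [he.sup_eq hle hge, idempotent_mul_add_one_sub_mul_pow he.isIdempotentElem he.commute,
    ← mul_add_one_sub_mul e a]
  exact add_le_add (mul_le_mul_of_nonneg_left hx he.nonneg)
    (mul_le_mul_of_nonneg_left hy he.one_sub.nonneg)

theorem le_sup_one_of_pow_le (hn : n ≠ 0) (h : x ^ n ≤ a) : x ≤ a ⊔ 1 :=
  calc x ≤ x ⊔ 1 := le_sup_left
    _ ≤ (x ⊔ 1) ^ n := le_self_pow₀ le_sup_right hn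
    _ ≤ a ⊔ 1 := sup_pow_le (h.trans le_sup_left) ((one_pow n).trans_le le_sup_right)

variable [Algebra ℝ A] [PosSMulMono ℝ A]

theorem pow_le_of_isLUB {T : Set A} (hT : SupClosed T) (hne : T.Nonempty)
    (hnonneg : ∀ x ∈ T, 0 ≤ x) (hr : IsLUB T r) (h : ∀ x ∈ T, x ^ n ≤ a) : r ^ n ≤ a := by
  obtain ⟨x₀, hx₀⟩ := hne
  have hr₀ : 0 ≤ r := (hnonneg x₀ hx₀).trans (hr.1 hx₀)
  -- The factors of `r ^ n` are replaced by elements of `T` one at a time.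
  have hmixed : ∀ j i, i + j = n → ∀ x ∈ T, x ^ i * r ^ j ≤ a := by
    intro j
    induction j with
    | zero =>
      rintro i rfl x hx
      simpa only [add_zero, pow_zero, mul_one] using h x hx
    | succ j ih =>
      intro i hij x hx
      rw [pow_succ' r, ← mul_assoc]
      refine (isLUB_image_mul_mul hr (pow_nonneg (hnonneg x hx) i) (pow_nonneg hr₀ j)).2 ?_
      rintro _ ⟨y, hy, rfl⟩
      have hxy : x ⊔ y ∈ T := hT hx hy
      refine le_trans (mul_le_mul_of_nonneg_right ?_ (pow_nonneg hr₀ j))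
        (ih (i + 1) (by omega) (x ⊔ y) hxy)
      rw [pow_succ]
      exact mul_le_mul (pow_le_pow_left₀ (hnonneg x hx) le_sup_left i) le_sup_right (hnonneg y hy)
        (pow_nonneg (hnonneg _ hxy) i)
  simpa only [pow_zero, one_mul] using hmixed n 0 (zero_add n) x₀ hx₀

theorem le_add_smul_one_pow_of_isLUB (hr : IsLUB {x | 0 ≤ x ∧ x ^ n ≤ a} r) (hr₀ : 0 ≤ r)
    (hra : r ^ n ≤ a) {δ : ℝ} (hδ : 0 < δ) : a ≤ (r + δ • 1) ^ n := by
  obtain ⟨e, he, hle, hge⟩ := exists_isComponent_mul_le_mul a ((r + δ • 1) ^ n)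
  have hmem : e * (r + δ • 1) + (1 - e) * r ∈ {x | 0 ≤ x ∧ x ^ n ≤ a} := by
    refine ⟨add_nonneg (mul_nonneg he.nonneg (add_nonneg hr₀ (smul_nonneg hδ.le zero_le_one)))
      (mul_nonneg he.one_sub.nonneg hr₀), ?_⟩
    rw [idempotent_mul_add_one_sub_mul_pow he.isIdempotentElem he.commute,
      ← mul_add_one_sub_mul e a]
    exact add_le_add hle (mul_le_mul_of_nonneg_left hra he.one_sub.nonneg)
  have he₀ : e = 0 := by
    refine le_antisymm ?_ he.nonneg
    have hsmul : r + δ • e ≤ r := by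
      have h := hr.1 hmem
      rwa [mul_add, add_right_comm, mul_add_one_sub_mul, mul_smul_comm, mul_one] at h
    rwa [add_le_iff_nonpos_right, ← smul_zero δ, smul_le_smul_iff_of_pos_left hδ] at hsmul
  simpa only [he₀, sub_zero, one_mul] using hge

theorem exists_nonneg_pow_eq (ha : 0 ≤ a) (hn : n ≠ 0) : ∃ r : A, 0 ≤ r ∧ r ^ n = a := by
  set T : Set A := {x | 0 ≤ x ∧ x ^ n ≤ a}
  have hzero : (0 : A) ∈ T := ⟨le_rfl, (zero_pow hn).trans_le ha⟩
  have hlub : IsLUB T (sSup T) :=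
    isLUB_csSup ⟨0, hzero⟩ ⟨a ⊔ 1, fun x hx => le_sup_one_of_pow_le hn hx.2⟩
  have hsup : SupClosed T := fun x hx y hy => ⟨hx.1.trans le_sup_left, sup_pow_le hx.2 hy.2⟩
  have hnonneg : 0 ≤ sSup T := hlub.1 hzero
  have hle : sSup T ^ n ≤ a :=
    pow_le_of_isLUB hsup ⟨0, hzero⟩ (fun x hx => hx.1) hlub fun x hx => hx.2
  refine ⟨sSup T, hnonneg, le_antisymm hle ?_⟩
  rw [← sub_nonpos]
  refine nonpos_of_forall_le_smul (y := (sSup T + 1) ^ n) fun δ hδ hδ' => ?_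
  rw [sub_le_iff_le_add']
  calc a ≤ (sSup T + δ • 1) ^ n := le_add_smul_one_pow_of_isLUB hlub hnonneg hle hδ
    _ ≤ (1 - δ) • sSup T ^ n + δ • (sSup T + 1) ^ n := add_smul_one_pow_le hnonneg hδ.le hδ' n
    _ ≤ sSup T ^ n + δ • (sSup T + 1) ^ n := by
      gcongr
      rw [sub_smul, one_smul]
      exact sub_le_self _ (smul_nonneg hδ.le (pow_nonneg hnonneg n))

theorem nthRoot_nonneg (ha : 0 ≤ a) (hn : n ≠ 0) : 0 ≤ nthRoot n a := by
  rw [nthRoot, dif_pos (exists_nonneg_pow_eq ha hn)]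
  exact (exists_nonneg_pow_eq ha hn).choose_spec.1

theorem nthRoot_pow (ha : 0 ≤ a) (hn : n ≠ 0) : nthRoot n a ^ n = a := by
  rw [nthRoot, dif_pos (exists_nonneg_pow_eq ha hn)]
  exact (exists_nonneg_pow_eq ha hn).choose_spec.2

end ConditionallyCompleteLattice

end Roots

section LateralCompleteness

variable {A : Type*} [Ring A] [ConditionallyCompleteLattice A] [IsOrderedAddMonoid A]
  [IsFAlgebra A] [IsUniversallyComplete A]

theorem exists_forall_mul_le_mul {ι : Type*} [Nonempty ι] {d c : ι → A}
    (hd : ∀ i, IsComponent (d i)) (hdisj : Pairwise fun i j => d i ⊓ d j = 0)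
    (hc : ∀ i, 0 ≤ c i) : ∃ b, 0 ≤ b ∧ ∀ i, d i * c i ≤ d i * b := by
  obtain ⟨b, hb⟩ := IsUniversallyComplete.exists_isLUB_of_pairwise_disjoint
    (range fun i => d i * c i) (range_nonempty _)
    (forall_mem_range.2 fun i => mul_nonneg (hd i).nonneg (hc i)) (by
      rintro _ ⟨i, rfl⟩ _ ⟨j, rfl⟩ hij
      exact mul_inf_mul_eq_zero (hdisj fun h => hij (h ▸ rfl)) (hc i) (hc j))
  obtain ⟨i₀⟩ := ‹Nonempty ι›
  refine ⟨b, (mul_nonneg (hd i₀).nonneg (hc i₀)).trans (hb.1 ⟨i₀, rfl⟩), fun i => ?_⟩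
  rw [← (hd i).mul_mul_self (c i)]
  exact mul_le_mul_of_nonneg_left (hb.1 ⟨i, rfl⟩) (hd i).nonneg

theorem bddAbove_range_of_forall_one_sub_mul_le [Algebra ℝ A] [PosSMulMono ℝ A] {e s c : ℕ → A}
    (he : ∀ n, IsComponent (e n)) (hanti : Antitone e) (hinf : IsGLB (range e) 0)
    (hc : ∀ n, 0 ≤ c n) (h : ∀ n m, (1 - e n) * s m ≤ c n) : BddAbove (range s) := by
  have hd : ∀ n, IsComponent (e n - e (n + 1)) := fun n =>
    (he n).sub (he (n + 1)) (hanti n.le_succ)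
  obtain ⟨b, hb, hdb⟩ := exists_forall_mul_le_mul (c := fun n => c (n + 1)) hd
    (IsComponent.pairwise_sub_succ_inf_eq_zero he hanti) fun n => hc (n + 1)
  refine ⟨c 0 + b, forall_mem_range.2 fun m => sub_nonpos.1 ?_⟩
  refine nonpos_of_forall_one_sub_mul_nonpos he hinf fun n => ?_
  rw [mul_sub, sub_nonpos]
  induction n with
  | zero =>
    rw [← (he 0).one_sub.mul_mul_self (s m)]
    exact mul_le_mul_of_nonneg_left ((h 0 m).trans (le_add_of_nonneg_right hb))
      (he 0).one_sub.nonneg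
  | succ n ih =>
    have hlayer : (e n - e (n + 1)) * s m ≤ (e n - e (n + 1)) * b := by
      have hle : e n - e (n + 1) ≤ 1 - e (n + 1) := sub_le_sub_right (he n).le_one _
      calc (e n - e (n + 1)) * s m
          = (e n - e (n + 1)) * ((1 - e (n + 1)) * s m) := by
            rw [← mul_assoc, ((hd n).commute (1 - e (n + 1))).eq,
              (he (n + 1)).one_sub.mul_eq_right_of_le (hd n) hle]
        _ ≤ (e n - e (n + 1)) * c (n + 1) :=
            mul_le_mul_of_nonneg_left (h (n + 1) m) (hd n).nonneg
        _ ≤ (e n - e (n + 1)) * b := hdb n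
    have hsplit : 1 - e (n + 1) = (1 - e n) + (e n - e (n + 1)) := by abel
    rw [hsplit, add_mul, add_mul]
    exact add_le_add ih (hlayer.trans
      (mul_le_mul_of_nonneg_left (le_add_of_nonneg_left (hc 0)) (hd n).nonneg))

end LateralCompleteness

section Egorov

variable {A : Type*} [Ring A] [ConditionallyCompleteLattice A] [IsOrderedAddMonoid A]
  [IsFAlgebra A] [Algebra ℝ A] [PosSMulMono ℝ A]

theorem exists_isComponent_one_sub_mul_le_smul {x : ℕ → A} (hx : Antitone x)
    (hinf : IsGLB (range x) 0) {ε : ℝ} (hε : 0 < ε) :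
    ∃ e : ℕ → A, (∀ n, IsComponent (e n)) ∧ Antitone e ∧ IsGLB (range e) 0 ∧
      ∀ n, (1 - e n) * x n ≤ ε • (1 - e n) := by
  have he : ∀ n, IsComponent (supportComponent (x n - ε • 1)) := fun n =>
    isComponent_supportComponent _
  have hsmul_le : ∀ n, ε • supportComponent (x n - ε • 1) ≤ x n := fun n => by
    have hnonneg := supportComponent_mul_nonneg (x n - ε • 1)
    rw [mul_sub, sub_nonneg, mul_smul_comm, mul_one] at hnonneg
    exact hnonneg.trans ((he n).mul_le_self (hinf.1 ⟨n, rfl⟩))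
  refine ⟨fun n => supportComponent (x n - ε • 1), he,
    fun m n h => supportComponent_mono (sub_le_sub_right (hx h) _),
    ⟨forall_mem_range.2 fun n => (he n).nonneg, fun b hb => ?_⟩, fun n => ?_⟩
  · rw [← smul_le_smul_iff_of_pos_left hε, smul_zero]
    exact hinf.2 <| forall_mem_range.2 fun n =>
      (smul_le_smul_of_nonneg_left (hb ⟨n, rfl⟩) hε.le).trans (hsmul_le n)
  · have hnonpos := one_sub_supportComponent_mul_nonpos (x n - ε • 1)
    rwa [mul_sub, sub_nonpos, mul_smul_comm, mul_one] at hnonpos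

theorem bddAbove_range_sum_of_forall_one_sub_mul_le [IsUniversallyComplete A] {e t : ℕ → A}
    (he : ∀ n, IsComponent (e n)) (hanti : Antitone e) (hinf : IsGLB (range e) 0)
    (ht : ∀ n, 0 ≤ t n) (h : ∀ N n, N < n → (1 - e N) * t n ≤ (1 / 2 : ℝ) ^ n • 1) :
    BddAbove (range fun m => ∑ n ∈ Finset.range (m + 1), t n) := by
  have hgeom : ∀ n, (0 : A) ≤ (1 / 2 : ℝ) ^ n • 1 := fun n =>
    smul_nonneg (by positivity) zero_le_one
  refine bddAbove_range_of_forall_one_sub_mul_le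
    (c := fun N => ∑ n ∈ Finset.range (N + 1), t n + (2 : ℝ) • 1) he hanti hinf
    (fun N => add_nonneg (Finset.sum_nonneg fun n _ => ht n)
      (smul_nonneg zero_le_two zero_le_one)) fun N m => ?_
  rw [Finset.mul_sum, ← Finset.sum_filter_add_sum_filter_not _ (· < N + 1)]
  refine add_le_add ?_ ?_
  · calc ∑ n ∈ Finset.range (m + 1) with n < N + 1, (1 - e N) * t n
        ≤ ∑ n ∈ Finset.range (m + 1) with n < N + 1, t n :=
          Finset.sum_le_sum fun n _ => (he N).one_sub.mul_le_self (ht n)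
      _ ≤ ∑ n ∈ Finset.range (N + 1), t n :=
          Finset.sum_le_sum_of_subset_of_nonneg
            (fun n hn => Finset.mem_range.2 (Finset.mem_filter.1 hn).2) fun n _ _ => ht n
  · calc ∑ n ∈ Finset.range (m + 1) with ¬n < N + 1, (1 - e N) * t n
        ≤ ∑ n ∈ Finset.range (m + 1) with ¬n < N + 1, (1 / 2 : ℝ) ^ n • (1 : A) :=
          Finset.sum_le_sum fun n hn => h N n (not_lt.1 (Finset.mem_filter.1 hn).2)
      _ ≤ ∑ n ∈ Finset.range (m + 1), (1 / 2 : ℝ) ^ n • (1 : A) :=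
          Finset.sum_le_sum_of_subset_of_nonneg (Finset.filter_subset _ _) fun n _ _ => hgeom n
      _ = (∑ n ∈ Finset.range (m + 1), (1 / 2 : ℝ) ^ n) • (1 : A) := (Finset.sum_smul ..).symm
      _ ≤ (2 : ℝ) • 1 := smul_le_smul_of_nonneg_right (sum_geometric_two_le _) zero_le_one

end Egorov

theorem abs_mul_le_abs_mul_abs {A : Type*} [Ring A] [Lattice A] [IsOrderedRing A] (x y : A) :
    |x * y| ≤ |x| * |y| := by
  have hle : ∀ x y : A, x * y ≤ |x| * |y| := fun x y => by
    have hcross : |x| * |y| = x * y + 2 • (x⁺ * y⁻ + x⁻ * y⁺) := by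
      have hxy : x * y = (x⁺ - x⁻) * (y⁺ - y⁻) := by
        rw [posPart_sub_negPart, posPart_sub_negPart]
      rw [← posPart_add_negPart x, ← posPart_add_negPart y, hxy]
      noncomm_ring
    rw [hcross]
    exact le_add_of_nonneg_right <| nsmul_nonneg (add_nonneg
      (mul_nonneg (posPart_nonneg x) (negPart_nonneg y))
      (mul_nonneg (negPart_nonneg x) (posPart_nonneg y))) 2
  refine abs_le'.2 ⟨hle x y, ?_⟩
  rw [← neg_mul, ← abs_neg x]
  exact hle (-x) y

namespace Cplx

section OfReal

variable {A : Type*} [Ring A]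

theorem ofReal_one_sub (x : A) : ofReal (1 - x) = 1 - ofReal x := by
  ext <;> simp [ofReal]

theorem isIdempotentElem_ofReal {x : A} (hx : IsIdempotentElem x) :
    IsIdempotentElem (ofReal x) := by
  ext <;> simp [ofReal, hx.eq]

theorem commute_ofReal {x : A} (hx : ∀ y, Commute x y) (z : Cplx A) : Commute (ofReal x) z := by
  ext <;> simp [ofReal, (hx _).eq]

end OfReal

section Modulus

variable {A : Type*} [Ring A] [ConditionallyCompleteLattice A] [IsOrderedAddMonoid A]
  [Algebra ℝ A] [PosSMulMono ℝ A]

theorem cos_smul_add_sin_smul_le_modulus (z : Cplx A) (θ : ℝ) :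
    Real.cos θ • z.re + Real.sin θ • z.im ≤ z.modulus := by
  have hper : Function.Periodic (fun θ : ℝ => Real.cos θ • z.re + Real.sin θ • z.im)
      (2 * Real.pi) := fun θ => by simp only [Real.cos_add_two_pi, Real.sin_add_two_pi]
  obtain ⟨y, hy, h⟩ := hper.exists_mem_Ico₀ Real.two_pi_pos θ
  rw [h]
  exact (isLUB_modulus z).1 ⟨⟨y, hy.1, hy.2.le⟩, rfl⟩

theorem modulus_le {z : Cplx A} {b : A}
    (h : ∀ θ : ℝ, Real.cos θ • z.re + Real.sin θ • z.im ≤ b) : z.modulus ≤ b :=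
  (isLUB_modulus z).2 (forall_mem_range.2 fun θ => h θ)

theorem abs_re_le_modulus (z : Cplx A) : |z.re| ≤ z.modulus := by
  refine abs_le'.2 ⟨?_, ?_⟩
  · simpa using cos_smul_add_sin_smul_le_modulus z 0
  · simpa using cos_smul_add_sin_smul_le_modulus z Real.pi

theorem abs_im_le_modulus (z : Cplx A) : |z.im| ≤ z.modulus := by
  refine abs_le'.2 ⟨?_, ?_⟩
  · simpa using cos_smul_add_sin_smul_le_modulus z (Real.pi / 2)
  · simpa using cos_smul_add_sin_smul_le_modulus z (-(Real.pi / 2))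

theorem le_modulus_ofReal (x : A) : x ≤ (ofReal x).modulus :=
  (le_abs_self x).trans (abs_re_le_modulus (ofReal x))

theorem modulus_nonneg (z : Cplx A) : 0 ≤ z.modulus :=
  (abs_nonneg _).trans (abs_re_le_modulus z)

theorem modulus_le_abs_add_abs (z : Cplx A) : z.modulus ≤ |z.re| + |z.im| :=
  modulus_le fun θ => add_le_add (smul_le_abs (Real.abs_cos_le_one θ) _)
    (smul_le_abs (Real.abs_sin_le_one θ) _)

theorem modulus_zero : (0 : Cplx A).modulus = 0 :=
  le_antisymm (by simpa using modulus_le_abs_add_abs (0 : Cplx A)) (modulus_nonneg _)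

theorem eq_zero_of_modulus_nonpos {z : Cplx A} (h : z.modulus ≤ 0) : z = 0 := by
  have eq_zero_of_abs_nonpos : ∀ x : A, |x| ≤ 0 → x = 0 := fun x hx =>
    le_antisymm (abs_le'.1 hx).1 (neg_nonpos.1 (abs_le'.1 hx).2)
  ext
  · exact eq_zero_of_abs_nonpos _ ((abs_re_le_modulus z).trans h)
  · exact eq_zero_of_abs_nonpos _ ((abs_im_le_modulus z).trans h)

theorem modulus_add_le (z w : Cplx A) : (z + w).modulus ≤ z.modulus + w.modulus :=
  modulus_le fun θ => by
    rw [add_re, add_im, smul_add, smul_add, add_add_add_comm]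
    exact add_le_add (cos_smul_add_sin_smul_le_modulus z θ) (cos_smul_add_sin_smul_le_modulus w θ)

theorem modulus_neg_le (z : Cplx A) : (-z).modulus ≤ z.modulus :=
  modulus_le fun θ => by simpa using cos_smul_add_sin_smul_le_modulus z (θ + Real.pi)

theorem modulus_sum_le {ι : Type*} (s : Finset ι) (g : ι → Cplx A) :
    (∑ n ∈ s, g n).modulus ≤ ∑ n ∈ s, (g n).modulus := by
  induction s using Finset.cons_induction with
  | empty => simp only [Finset.sum_empty, modulus_zero, le_refl]
  | cons k s hk ih =>
    rw [Finset.sum_cons, Finset.sum_cons]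
    exact (modulus_add_le _ _).trans (add_le_add le_rfl ih)

variable [IsFAlgebra A]

-- The sharp constant is `1`; any constant serves for the root test at radii disjoint to `L`.
theorem modulus_mul_le (z w : Cplx A) :
    (z * w).modulus ≤ (4 : ℝ) • (z.modulus * w.modulus) := by
  have hmul : ∀ x y : A, |x| ≤ z.modulus → |y| ≤ w.modulus →
      |x * y| ≤ z.modulus * w.modulus := fun x y hx hy =>
    (abs_mul_le_abs_mul_abs x y).trans (mul_le_mul hx hy (abs_nonneg y) (modulus_nonneg z))
  have hre : |(z * w).re| ≤ z.modulus * w.modulus + z.modulus * w.modulus := by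
    rw [mul_re, sub_eq_add_neg]
    refine (abs_add_le _ _).trans
      (add_le_add (hmul _ _ (abs_re_le_modulus z) (abs_re_le_modulus w)) ?_)
    rw [abs_neg]
    exact hmul _ _ (abs_im_le_modulus z) (abs_im_le_modulus w)
  have him : |(z * w).im| ≤ z.modulus * w.modulus + z.modulus * w.modulus := by
    rw [mul_im]
    exact (abs_add_le _ _).trans (add_le_add
      (hmul _ _ (abs_re_le_modulus z) (abs_im_le_modulus w))
      (hmul _ _ (abs_im_le_modulus z) (abs_re_le_modulus w)))
  calc (z * w).modulus ≤ |(z * w).re| + |(z * w).im| := modulus_le_abs_add_abs _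
    _ ≤ z.modulus * w.modulus + z.modulus * w.modulus +
        (z.modulus * w.modulus + z.modulus * w.modulus) := add_le_add hre him
    _ = (4 : ℝ) • (z.modulus * w.modulus) := by
      generalize z.modulus * w.modulus = y
      module

theorem modulus_mul_pow_le (a : Cplx A) {w : Cplx A} {r : A} (h : w.modulus ≤ r) (n : ℕ) :
    (a * w ^ n).modulus ≤ (4 : ℝ) ^ n • (a.modulus * r ^ n) := by
  have hr : 0 ≤ r := (modulus_nonneg w).trans h
  induction n with
  | zero => simp only [pow_zero, mul_one, one_smul, le_refl]
  | succ n ih =>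
    have hnonneg : 0 ≤ (4 : ℝ) ^ n • (a.modulus * r ^ n) :=
      smul_nonneg (by positivity) (mul_nonneg (modulus_nonneg a) (pow_nonneg hr n))
    calc (a * w ^ (n + 1)).modulus = (a * w ^ n * w).modulus := by rw [pow_succ, mul_assoc]
      _ ≤ (4 : ℝ) • ((a * w ^ n).modulus * w.modulus) := modulus_mul_le _ _
      _ ≤ (4 : ℝ) • (((4 : ℝ) ^ n • (a.modulus * r ^ n)) * r) :=
        smul_le_smul_of_nonneg_left (mul_le_mul ih h (modulus_nonneg w) hnonneg) (by norm_num)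
      _ = (4 : ℝ) ^ (n + 1) • (a.modulus * r ^ (n + 1)) := by
        rw [smul_mul_assoc, smul_smul, mul_assoc, ← pow_succ, ← pow_succ']

theorem modulus_ofReal_mul_le {x : A} (hx : 0 ≤ x) (z : Cplx A) :
    (ofReal x * z).modulus ≤ x * z.modulus :=
  modulus_le fun θ => by
    simpa [ofReal, mul_add] using
      mul_le_mul_of_nonneg_left (cos_smul_add_sin_smul_le_modulus z θ) hx

end Modulus

end Cplx

section WeierstrassTest

open Cplx

theorem isGLB_range_sub_of_isLUB {A : Type*} [AddCommGroup A] [PartialOrder A]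
    [IsOrderedAddMonoid A] {s : ℕ → A} {T : A} (hT : IsLUB (range s) T) :
    IsGLB (range fun m => T - s m) 0 := by
  refine ⟨forall_mem_range.2 fun m => sub_nonneg.2 (hT.1 ⟨m, rfl⟩), fun b hb => ?_⟩
  have hle : T ≤ T - b := hT.2 <| forall_mem_range.2 fun m => le_sub_comm.1 (hb ⟨m, rfl⟩)
  rwa [le_sub_self_iff] at hle

variable {A : Type*} [Ring A] [ConditionallyCompleteLattice A] [IsOrderedAddMonoid A]
  [Algebra ℝ A] [PosSMulMono ℝ A]

theorem exists_forall_modulus_sub_le {σ : ℕ → Cplx A} {p : ℕ → A}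
    (h : ∀ m k, m ≤ k → (σ m - σ k).modulus ≤ p m) :
    ∃ w, ∀ m, (σ m - w).modulus ≤ p m + p m := by
  obtain ⟨x, hx⟩ := exists_forall_abs_sub_le (x := fun m => (σ m).re) fun m k hmk =>
    (abs_re_le_modulus (σ m - σ k)).trans (h m k hmk)
  obtain ⟨y, hy⟩ := exists_forall_abs_sub_le (x := fun m => (σ m).im) fun m k hmk =>
    (abs_im_le_modulus (σ m - σ k)).trans (h m k hmk)
  exact ⟨⟨x, y⟩, fun m => (modulus_le_abs_add_abs _).trans (add_le_add (hx m) (hy m))⟩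

theorem exists_forall_modulus_sum_sub_le {g : ℕ → Cplx A} {t : ℕ → A} {T : A}
    (hg : ∀ n, (g n).modulus ≤ t n)
    (hT : IsLUB (range fun m => ∑ n ∈ Finset.range (m + 1), t n) T) :
    ∃ w, ∀ m, (∑ n ∈ Finset.range (m + 1), g n - w).modulus ≤
      (T - ∑ n ∈ Finset.range (m + 1), t n) + (T - ∑ n ∈ Finset.range (m + 1), t n) := by
  refine exists_forall_modulus_sub_le (σ := fun m => ∑ n ∈ Finset.range (m + 1), g n)
    (p := fun m => T - ∑ n ∈ Finset.range (m + 1), t n) fun m k hmk => ?_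
  have hmk' : m + 1 ≤ k + 1 := Nat.succ_le_succ hmk
  calc (∑ n ∈ Finset.range (m + 1), g n - ∑ n ∈ Finset.range (k + 1), g n).modulus
      = (-∑ n ∈ Finset.Ico (m + 1) (k + 1), g n).modulus := by
        rw [Finset.sum_Ico_eq_sub _ hmk', neg_sub]
    _ ≤ (∑ n ∈ Finset.Ico (m + 1) (k + 1), g n).modulus := modulus_neg_le _
    _ ≤ ∑ n ∈ Finset.Ico (m + 1) (k + 1), (g n).modulus := modulus_sum_le _ _
    _ ≤ ∑ n ∈ Finset.Ico (m + 1) (k + 1), t n := Finset.sum_le_sum fun n _ => hg n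
    _ = ∑ n ∈ Finset.range (k + 1), t n - ∑ n ∈ Finset.range (m + 1), t n :=
        Finset.sum_Ico_eq_sub _ hmk'
    _ ≤ T - ∑ n ∈ Finset.range (m + 1), t n := sub_le_sub_right (hT.1 ⟨k, rfl⟩) _

theorem convergesUniformlyInOrder_of_modulus_le {a : ℕ → Cplx A} {c : Cplx A}
    {D : Set (Cplx A)} {t : ℕ → A} (ht₀ : ∀ n, 0 ≤ t n)
    (ht : ∀ n, ∀ z ∈ D, (a n * (z - c) ^ n).modulus ≤ t n)
    (hbdd : BddAbove (range fun m => ∑ n ∈ Finset.range (m + 1), t n)) :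
    ConvergesUniformlyInOrder a c D := by
  set s : ℕ → A := fun m => ∑ n ∈ Finset.range (m + 1), t n
  have hs : Monotone s := fun m k hmk => Finset.sum_le_sum_of_subset_of_nonneg
    (Finset.range_subset_range.2 (Nat.succ_le_succ hmk)) fun n _ _ => ht₀ n
  have hT : IsLUB (range s) (⨆ m, s m) := isLUB_ciSup hbdd
  set p : ℕ → A := fun m => (⨆ k, s k) - s m
  have hp : Antitone p := fun m k hmk => sub_le_sub_left (hs hmk) _
  have hinf : IsGLB (range p) 0 := isGLB_range_sub_of_isLUB hT
  choose! S hS using fun z hz => exists_forall_modulus_sum_sub_le (fun n => ht n z hz) hT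
  exact ⟨S, p + p, hp.add hp, add_zero (0 : A) ▸ isGLB_range_add_of_antitone hp hp hinf hinf,
    fun m z hz => hS z hz m⟩

end WeierstrassTest

section RadiiSet

open Cplx

theorem sum_mul_zero_pow {R : Type*} [Ring R] (a : ℕ → R) (m : ℕ) :
    ∑ n ∈ Finset.range (m + 1), a n * 0 ^ n = a 0 := by
  simp [Finset.sum_range_succ']

theorem sum_mul_pow_eq_of_isIdempotentElem {R : Type*} [Ring R] {e : R}
    (he : IsIdempotentElem e) (hcomm : ∀ x, Commute e x) (a : ℕ → R) (w : R) (m : ℕ) :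
    ∑ n ∈ Finset.range (m + 1), a n * w ^ n =
      ∑ n ∈ Finset.range (m + 1), a n * (e * w) ^ n +
        ∑ n ∈ Finset.range (m + 1), a n * ((1 - e) * w) ^ n - a 0 := by
  rw [← sum_mul_zero_pow a m, ← Finset.sum_add_distrib, ← Finset.sum_sub_distrib]
  refine Finset.sum_congr rfl fun n _ => ?_
  rw [pow_eq_idempotent_mul_pow_add_pow_sub he hcomm w n, mul_sub, mul_add]

section Solid

variable {A : Type*} [Ring A] [ConditionallyCompleteLattice A] [Algebra ℝ A]
  {a : ℕ → Cplx A} {c : Cplx A} {r s : A}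

theorem add_mem_orderBall {w : Cplx A} : c + w ∈ orderBall c r ↔ w.modulus ≤ r := by
  rw [orderBall, mem_ofPred_eq, add_sub_cancel_left]

theorem mem_radiiSet_of_le (hr : r ∈ radiiSet a c) (hs : 0 ≤ s) (hsr : s ≤ r) :
    s ∈ radiiSet a c := by
  obtain ⟨_, S, p, hp, hinf, hS⟩ := hr
  exact ⟨hs, S, p, hp, hinf, fun m z hz => hS m z (le_trans hz hsr)⟩

variable [IsOrderedAddMonoid A] [PosSMulMono ℝ A]

theorem zero_mem_radiiSet (a : ℕ → Cplx A) (c : Cplx A) : 0 ∈ radiiSet a c := by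
  refine ⟨le_rfl, fun _ => a 0, 0, antitone_const, by simp, fun m z hz => ?_⟩
  rw [eq_zero_of_modulus_nonpos hz, sum_mul_zero_pow, sub_self, modulus_zero, Pi.zero_apply]

variable [IsFAlgebra A]

theorem modulus_ofReal_mul_le_of_isComponent {e : A} (he : IsComponent e) (hr : 0 ≤ r)
    (h : e * s ≤ e * r) {w : Cplx A} (hw : w.modulus ≤ r ⊔ s) : (ofReal e * w).modulus ≤ r :=
  calc (ofReal e * w).modulus ≤ e * w.modulus := modulus_ofReal_mul_le he.nonneg w
    _ ≤ e * (r ⊔ s) := mul_le_mul_of_nonneg_left hw he.nonneg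
    _ = e * r := he.mul_sup_eq h
    _ ≤ r := he.mul_le_self hr

theorem sup_mem_radiiSet (hr : r ∈ radiiSet a c) (hs : s ∈ radiiSet a c) :
    r ⊔ s ∈ radiiSet a c := by
  obtain ⟨hr₀, S, p, hp, hpinf, hS⟩ := hr
  obtain ⟨hs₀, S', q, hq, hqinf, hS'⟩ := hs
  obtain ⟨e, he, hle, hge⟩ := exists_isComponent_mul_le_mul r s
  refine ⟨hr₀.trans le_sup_left,
    fun z => S (c + ofReal e * (z - c)) + S' (c + (1 - ofReal e) * (z - c)) - a 0, p + q,
    hp.add hq, add_zero (0 : A) ▸ isGLB_range_add_of_antitone hp hq hpinf hqinf, fun m z hz => ?_⟩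
  obtain ⟨w, rfl⟩ : ∃ w, z = c + w := ⟨z - c, (add_sub_cancel c z).symm⟩
  rw [add_mem_orderBall] at hz
  have hwr : c + ofReal e * w ∈ orderBall c r :=
    add_mem_orderBall.2 (modulus_ofReal_mul_le_of_isComponent he hr₀ hle hz)
  have hws : c + (1 - ofReal e) * w ∈ orderBall c s := by
    rw [add_mem_orderBall, ← ofReal_one_sub]
    exact modulus_ofReal_mul_le_of_isComponent he.one_sub hs₀ hge (sup_comm r s ▸ hz)
  have hSr := hS m _ hwr
  have hSs := hS' m _ hws
  simp only [add_sub_cancel_left] at hSr hSs ⊢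
  rw [sum_mul_pow_eq_of_isIdempotentElem (isIdempotentElem_ofReal he.isIdempotentElem)
    (commute_ofReal he.commute) a w m, sub_sub_sub_cancel_right, add_sub_add_comm]
  exact (modulus_add_le _ _).trans (add_le_add hSr hSs)

theorem isSolidSublatticeOfCone_radiiSet (a : ℕ → Cplx A) (c : Cplx A) :
    IsSolidSublatticeOfCone (radiiSet a c) where
  nonneg _ hr := hr.1
  nonempty := ⟨0, zero_mem_radiiSet a c⟩
  solid _ hr _ hs hsr := mem_radiiSet_of_le hr hs hsr
  sup_mem _ hr _ hs := sup_mem_radiiSet hr hs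
  inf_mem _ hr _ hs := mem_radiiSet_of_le hr (le_inf hr.1 hs.1) inf_le_left

end Solid

end RadiiSet

section TailSup

variable {A : Type*} [ConditionallyCompleteLattice A] {x : ℕ → A}

/-- The supremum of the tail `x_n, x_{n+1}, …`, whose infimum over `n` is the limit superior of
`x`; it is meaningful for sequences that are bounded above. -/
noncomputable def tailSup (x : ℕ → A) (n : ℕ) : A := ⨆ m : Ici n, x m

theorem le_tailSup (hx : BddAbove (range x)) {m n : ℕ} (h : n ≤ m) : x m ≤ tailSup x n :=
  le_ciSup (f := fun m : Ici n => x m) (hx.mono (range_comp_subset_range _ x)) ⟨m, h⟩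

theorem tailSup_antitone (hx : BddAbove (range x)) : Antitone (tailSup x) := fun _ _ h =>
  ciSup_le fun m => le_tailSup hx (h.trans m.2)

theorem isGLB_range_tailSup (hx : BddAbove (range x)) (hx' : BddBelow (range x)) :
    IsGLB (range (tailSup x)) (⨅ n, tailSup x n) := by
  obtain ⟨l, hl⟩ := hx'
  exact isGLB_ciInf ⟨l, forall_mem_range.2 fun n => (hl ⟨n, rfl⟩).trans (le_tailSup hx le_rfl)⟩

end TailSup

section RootTest

open Cplx

theorem IsComponent.mul_pow_smul_le {A : Type*} [Ring A] [PartialOrder A] [IsOrderedRing A]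
    [Algebra ℝ A] [PosSMulMono ℝ A] {e v r y : A} {α ε : ℝ} (he : IsComponent e) (hα : 0 ≤ α)
    (hε : 0 ≤ ε) (hv : 0 ≤ v) (hr : 0 ≤ r) (h : e * (v * r) ≤ ε • e) {n : ℕ} (hy : y ≤ v ^ n) :
    e * (α ^ n • (y * r ^ n)) ≤ (α * ε) ^ n • 1 :=
  calc e * (α ^ n • (y * r ^ n)) = α ^ n • (e * (y * r ^ n)) := mul_smul_comm _ _ _
    _ ≤ α ^ n • (e * (v ^ n * r ^ n)) :=
        smul_le_smul_of_nonneg_left (mul_le_mul_of_nonneg_left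
          (mul_le_mul_of_nonneg_right hy (pow_nonneg hr n)) he.nonneg) (pow_nonneg hα n)
    _ ≤ α ^ n • ε ^ n • e :=
        smul_le_smul_of_nonneg_left (he.mul_mul_pow_le hv hr hε h n) (pow_nonneg hα n)
    _ = (α * ε) ^ n • e := by rw [smul_smul, ← mul_pow]
    _ ≤ (α * ε) ^ n • 1 :=
        smul_le_smul_of_nonneg_left he.le_one (pow_nonneg (mul_nonneg hα hε) n)

variable {A : Type*} [Ring A] [ConditionallyCompleteLattice A] [IsOrderedAddMonoid A]
  [Algebra ℝ A] [PosSMulMono ℝ A]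

theorem inf_eq_zero_of_mem_disjointComplement_bandGenerated {x y : A} (hx : 0 ≤ x)
    (hy : 0 ≤ y) (h : ofReal x ∈ disjointComplement (bandGenerated (ofReal y) : Set (Cplx A))) :
    y ⊓ x = 0 := by
  have hmem : ofReal y ∈ bandGenerated (ofReal y) := by
    rw [bandGenerated, Submodule.mem_sInf]
    exact fun B hB => hB.2
  refine le_antisymm ?_ (le_inf hy hx)
  rw [← h _ hmem, inf_comm]
  exact inf_le_inf (le_modulus_ofReal x) (le_modulus_ofReal y)

variable [IsFAlgebra A]

theorem rootSeq_nonneg (a : ℕ → Cplx A) (k : ℕ) : 0 ≤ rootSeq a k :=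
  nthRoot_nonneg (modulus_nonneg _) k.succ_ne_zero

theorem rootSeq_pow (a : ℕ → Cplx A) (k : ℕ) : rootSeq a k ^ (k + 1) = (a (k + 1)).modulus :=
  nthRoot_pow (modulus_nonneg _) k.succ_ne_zero

variable [IsUniversallyComplete A]

theorem mem_radiiSet_of_modulus_le_pow {a : ℕ → Cplx A} {c : Cplx A} {v : ℕ → A} {L r : A}
    (hv : Antitone v) (hL : IsGLB (range v) L) (hv₀ : ∀ k, 0 ≤ v k) (hr : 0 ≤ r)
    (hLr : L * r = 0)
    (hav : ∀ k, (a (k + 1)).modulus ≤ v k ^ (k + 1)) : r ∈ radiiSet a c := by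
  have hanti : Antitone fun k => v k * r := fun m k hmk =>
    mul_le_mul_of_nonneg_right (hv hmk) hr
  have hinf : IsGLB (range fun k => v k * r) 0 := by
    have h := isGLB_image_mul_mul hL zero_le_one hr
    rw [one_mul, hLr, ← range_comp] at h
    simpa only [Function.comp_def, one_mul] using h
  obtain ⟨e, he, he_anti, he_inf, hsmall⟩ :=
    exists_isComponent_one_sub_mul_le_smul hanti hinf (ε := 1 / 8) (by norm_num)
  have ht₀ : ∀ n, 0 ≤ (4 : ℝ) ^ n • ((a n).modulus * r ^ n) := fun n =>
    smul_nonneg (by positivity) (mul_nonneg (modulus_nonneg _) (pow_nonneg hr n))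
  refine ⟨hr, convergesUniformlyInOrder_of_modulus_le ht₀
    (fun n z hz => modulus_mul_pow_le (a n) hz n)
    (bddAbove_range_sum_of_forall_one_sub_mul_le he he_anti he_inf ht₀ fun N n hNn => ?_)⟩
  obtain ⟨k, rfl⟩ : ∃ k, n = k + 1 := Nat.exists_eq_succ_of_ne_zero (Nat.ne_zero_of_lt hNn)
  have hk : (1 - e N) * (v k * r) ≤ (1 / 8 : ℝ) • (1 - e N) :=
    (mul_le_mul_of_nonneg_left (hanti (Nat.le_of_lt_succ hNn)) (he N).one_sub.nonneg).trans
      (hsmall N)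
  rw [show (1 / 2 : ℝ) = 4 * (1 / 8) by norm_num]
  exact (he N).one_sub.mul_pow_smul_le (by norm_num) (by norm_num) (hv₀ k) hr hk (hav k)

theorem mem_radiiSet_of_mem_disjointComplement {a : ℕ → Cplx A} {c : Cplx A} {r : A}
    (hr : 0 ≤ r) (ha : BddAbove (range (rootSeq a)))
    (h : ofReal r ∈ disjointComplement
      (bandGenerated (ofReal (orderLimsup (rootSeq a))) : Set (Cplx A))) :
    r ∈ radiiSet a c := by
  have hnonneg : ∀ k, 0 ≤ tailSup (rootSeq a) k := fun k =>
    (rootSeq_nonneg a k).trans (le_tailSup ha le_rfl)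
  have hL : IsGLB (range (tailSup (rootSeq a))) (orderLimsup (rootSeq a)) :=
    isGLB_range_tailSup ha ⟨0, forall_mem_range.2 (rootSeq_nonneg a)⟩
  have hdisj : orderLimsup (rootSeq a) ⊓ r = 0 :=
    inf_eq_zero_of_mem_disjointComplement_bandGenerated hr
      (hL.2 (forall_mem_range.2 hnonneg)) h
  refine mem_radiiSet_of_modulus_le_pow (tailSup_antitone ha) hL hnonneg hr
    (mul_eq_zero_of_inf_eq_zero hdisj) fun k => ?_
  rw [← rootSeq_pow a k]
  exact pow_le_pow_left₀ (rootSeq_nonneg a k) (le_tailSup ha le_rfl) _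

end RootTest

end CVL

theorem proposition3p9 {A : Type*} [Ring A] [ConditionallyCompleteLattice A]
    [IsOrderedAddMonoid A] [Algebra ℝ A] [PosSMulMono ℝ A]
    [CVL.IsArchimedeanLattice A] [CVL.IsUniversallyComplete A] [CVL.IsFAlgebra A]
    (a : ℕ → CVL.Cplx A) (c : CVL.Cplx A) :
    CVL.IsSolidSublatticeOfCone (CVL.radiiSet a c) ∧
    (CVL.IsOrderBounded (Set.range (CVL.rootSeq a)) →
      ∀ r : A, 0 ≤ r →
        CVL.Cplx.ofReal r ∈ CVL.disjointComplement
          (CVL.bandGenerated (CVL.Cplx.ofReal (CVL.orderLimsup (CVL.rootSeq a))) :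
            Set (CVL.Cplx A)) →
        r ∈ CVL.radiiSet a c) :=
  ⟨CVL.isSolidSublatticeOfCone_radiiSet a c, fun ⟨_, u, hu⟩ _ hr h =>
    CVL.mem_radiiSet_of_mem_disjointComplement hr ⟨u, fun _ hx => (hu hx).2⟩ h⟩
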